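/- Let $N$ be a smooth (Hausdorff) manifold of dimension $n$. An almost contact metric structure $(g,\xi,\eta,\varphi)$ on $N$ consists of a Riemannian metric $g$, a unit vector field $\xi$, the $1$-form $\eta=g(\xi,\cdot)$ and a bundle endomorphism $\varphi$ of $TN$ (all smooth) such that $\varphi(\xi)=0$, $\varphi^2=-1+\eta\otimes\xi$ and $g(\varphi X,\varphi Y)=g(X,Y)-\eta(X)\eta(Y)$. Its fundamental $2$-form is $F(X,Y)=g(\varphi X,Y)$. It is normal if $$[\varphi X,\varphi Y]+\varphi^2[X,Y]-\varphi[\varphi X,Y]-\varphi[X,\varphi Y]+d\eta(X,Y)\,\xi=0$$ for all vector fields $X,Y$, where $d\eta(X,Y)=X(\eta(Y))-Y(\eta(X))-\eta([X,Y])$. An ST (Sasaki with torsion) manifold is a manifold with a normal almost contact metric structure such that $\xi$ is a Killing vector field, $\mathcal L_\xi g=0$. A quasi-Sasaki manifold is a manifold with a normal almost contact metric structure such that $dF=0$. The torsion $3$-form is $c=\eta\wedge d\eta+dF(\varphi\cdot,\varphi\cdot,\varphi\cdot)$, the Lee $1$-form is $\vartheta(X)=-\frac12\sum_{i=1}^n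 c(\varphi X,E_i,\varphi E_i)$ for any local orthonormal frame $E_1,\dots,E_n$ (it does not depend on the frame), and an ST manifold is balanced if $\vartheta=0$ identically. **Proposition.** On every $5$-dimensional ST manifold $(N,g,\xi,\eta,\varphi)$ one has $dF=\vartheta\wedge F$, and the manifold is balanced if and only if it is quasi-Sasaki. -/

import Mathlib

open Bundle
open scoped Manifold ContDiff

noncomputable section

/-- The exterior derivative of a differential `k`-form `θ` on a smooth `n`-manifold: at `p`, pull
`θ` back to the model space along the inverse of the chart at `p`, take the exterior derivative
there, and pull the result back to `T_pM` along the chart. The normalization is the one in which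
`dη(X, Y) = X(η(Y)) - Y(η(X)) - η([X, Y])`. -/
def formExtDeriv {n : ℕ} {M : Type*} [TopologicalSpace M]
    [ChartedSpace (EuclideanSpace ℝ (Fin n)) M] {k : ℕ}
    (θ : ∀ p : M, TangentSpace (𝓡 n) p [⋀^Fin k]→L[ℝ] ℝ) (p : M) :
    TangentSpace (𝓡 n) p [⋀^Fin (k + 1)]→L[ℝ] ℝ :=
  ContinuousAlternatingMap.compContinuousLinearMap
    (extDeriv (E := EuclideanSpace ℝ (Fin n)) (F := ℝ)
      (fun y => (θ ((extChartAt (𝓡 n) p).symm y)).compContinuousLinearMap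
        (mfderiv (𝓡 n) (𝓡 n) (extChartAt (𝓡 n) p).symm y))
      (extChartAt (𝓡 n) p p))
    (mfderiv (𝓡 n) (𝓡 n) (extChartAt (𝓡 n) p) p)

/-- The wedge product of a `1`-form and a `2`-form on a vector space, evaluated on three vectors:
`(α ∧ β)(X, Y, Z) = α(X) β(Y, Z) + α(Y) β(Z, X) + α(Z) β(X, Y)`. -/
def wedgeOneTwo {V : Type*} (α : V → ℝ) (β : V → V → ℝ) (X Y Z : V) : ℝ :=
  α X * β Y Z + α Y * β Z X + α Z * β X Y

/-- An almost contact metric structure `(g, ξ, η, φ)` on a smooth `n`-manifold `M`, with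
`η = g(ξ, ·)`. All the data are smooth. (The axioms force `n` to be odd if `M` is nonempty.) -/
structure AlmostContactMetric (n : ℕ) (M : Type*) [TopologicalSpace M]
    [ChartedSpace (EuclideanSpace ℝ (Fin n)) M] [IsManifold (𝓡 n) ∞ M] where
  /-- the Riemannian metric -/
  g : ContMDiffRiemannianMetric (𝓡 n) ∞ (EuclideanSpace ℝ (Fin n))
    (fun p : M => TangentSpace (𝓡 n) p)
  /-- the Reeb vector field -/
  ξ : ContMDiffSection (𝓡 n) (EuclideanSpace ℝ (Fin n)) ∞ (fun p : M => TangentSpace (𝓡 n) p)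
  /-- the bundle endomorphism of the tangent bundle -/
  φ : ContMDiffSection (𝓡 n) (EuclideanSpace ℝ (Fin n) →L[ℝ] EuclideanSpace ℝ (Fin n)) ∞
    (fun p : M => TangentSpace (𝓡 n) p →L[ℝ] TangentSpace (𝓡 n) p)
  unit_ξ : ∀ p : M, g.inner p (ξ p) (ξ p) = 1
  φ_ξ : ∀ p : M, φ p (ξ p) = 0
  φ_sq : ∀ (p : M) (X : TangentSpace (𝓡 n) p), φ p (φ p X) = -X + g.inner p (ξ p) X • ξ p
  compat : ∀ (p : M) (X Y : TangentSpace (𝓡 n) p),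
    g.inner p (φ p X) (φ p Y) = g.inner p X Y - g.inner p (ξ p) X * g.inner p (ξ p) Y

namespace AlmostContactMetric

variable {n : ℕ} {M : Type*} [TopologicalSpace M]
  [ChartedSpace (EuclideanSpace ℝ (Fin n)) M] [IsManifold (𝓡 n) ∞ M]

/-- The `1`-form `η = g(ξ, ·)`. -/
def η (A : AlmostContactMetric n M) (p : M) : TangentSpace (𝓡 n) p [⋀^Fin 1]→L[ℝ] ℝ :=
  ContinuousAlternatingMap.ofSubsingleton ℝ (TangentSpace (𝓡 n) p) ℝ (0 : Fin 1)
    (A.g.inner p (A.ξ p))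

theorem η_φ (A : AlmostContactMetric n M) (p : M) (X : TangentSpace (𝓡 n) p) :
    A.g.inner p (A.ξ p) (A.φ p X) = 0 := by
  have h := A.φ_sq p (A.φ p X)
  rw [A.φ_sq p X, map_add, map_neg, map_smul, A.φ_ξ, smul_zero, add_zero] at h
  have h2 : A.g.inner p (A.ξ p) (A.φ p X) • A.ξ p = 0 := by simpa using h
  have h3 := congrArg (A.g.inner p (A.ξ p)) h2
  simpa [A.unit_ξ p] using h3

theorem inner_φ_self (A : AlmostContactMetric n M) (p : M) (X : TangentSpace (𝓡 n) p) :
    A.g.inner p (A.φ p X) X = 0 := by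
  have h := A.compat p X (A.φ p X)
  rw [A.φ_sq p X, A.η_φ, mul_zero, sub_zero, map_add, map_neg, map_smul,
    A.g.symm p (A.φ p X) (A.ξ p), A.η_φ, smul_zero, add_zero, A.g.symm p X] at h
  linarith

/-- The fundamental `2`-form `F(X, Y) = g(φ(X), Y)`. -/
def F (A : AlmostContactMetric n M) (p : M) : TangentSpace (𝓡 n) p [⋀^Fin 2]→L[ℝ] ℝ where
  toFun v := A.g.inner p (A.φ p (v 0)) (v 1)
  map_update_add' v i x y := by
    fin_cases i <;> simp
  map_update_smul' v i c x := by
    fin_cases i <;> simp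
  map_eq_zero_of_eq' v i j h hij := by
    have h01 : v 0 = v 1 := by
      fin_cases i <;> fin_cases j <;> simp_all
    simpa [h01] using A.inner_φ_self p (v 1)
  cont := by
    let G : EuclideanSpace ℝ (Fin n) →L[ℝ] EuclideanSpace ℝ (Fin n) →L[ℝ] ℝ :=
      (A.g.inner p).comp (A.φ p)
    have h : Continuous fun v : Fin 2 → EuclideanSpace ℝ (Fin n) => G (v 0) (v 1) := by fun_prop
    exact h

@[simp]
theorem F_apply (A : AlmostContactMetric n M) (p : M) (v : Fin 2 → TangentSpace (𝓡 n) p) :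
    A.F p v = A.g.inner p (A.φ p (v 0)) (v 1) := rfl

/-- The `2`-form `dη`. -/
def dη (A : AlmostContactMetric n M) (p : M) : TangentSpace (𝓡 n) p [⋀^Fin 2]→L[ℝ] ℝ :=
  formExtDeriv A.η p

/-- The `3`-form `dF`. -/
def dF (A : AlmostContactMetric n M) (p : M) : TangentSpace (𝓡 n) p [⋀^Fin 3]→L[ℝ] ℝ :=
  formExtDeriv A.F p

/-- The Sasaki–Hatakeyama tensor
`S(X, Y) = [φX, φY] + φ²[X, Y] - φ[φX, Y] - φ[X, φY] + dη(X, Y) ξ` of two vector fields. -/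
def sasakiHatakeyama (A : AlmostContactMetric n M) (X Y : ∀ p : M, TangentSpace (𝓡 n) p) (p : M) :
    TangentSpace (𝓡 n) p :=
  VectorField.mlieBracket (𝓡 n) (fun q => A.φ q (X q)) (fun q => A.φ q (Y q)) p
    + A.φ p (A.φ p (VectorField.mlieBracket (𝓡 n) X Y p))
    - A.φ p (VectorField.mlieBracket (𝓡 n) (fun q => A.φ q (X q)) Y p)
    - A.φ p (VectorField.mlieBracket (𝓡 n) X (fun q => A.φ q (Y q)) p)
    + A.dη p ![X p, Y p] • A.ξ p

/-- The structure is normal if the Sasaki–Hatakeyama tensor vanishes on all pairs of smooth vector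
fields. -/
def IsNormal (A : AlmostContactMetric n M) : Prop :=
  ∀ (X Y : ContMDiffSection (𝓡 n) (EuclideanSpace ℝ (Fin n)) ∞
      (fun p : M => TangentSpace (𝓡 n) p)) (p : M),
    A.sasakiHatakeyama X Y p = 0

/-- The derivative of a function `f` on `M` at `p` in the direction of `v ∈ T_pM`. -/
def dirDeriv (f : M → ℝ) (p : M) (v : TangentSpace (𝓡 n) p) : ℝ :=
  mfderiv (𝓡 n) 𝓘(ℝ, ℝ) f p v

/-- The Reeb field is a Killing field, `ℒ_ξ g = 0`, that is
`ξ(g(X, Y)) - g([ξ, X], Y) - g(X, [ξ, Y]) = 0` for all smooth vector fields `X`, `Y`. -/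
def IsKillingReeb (A : AlmostContactMetric n M) : Prop :=
  ∀ (X Y : ContMDiffSection (𝓡 n) (EuclideanSpace ℝ (Fin n)) ∞
      (fun p : M => TangentSpace (𝓡 n) p)) (p : M),
    dirDeriv (fun q => A.g.inner q (X q) (Y q)) p (A.ξ p)
      - A.g.inner p (VectorField.mlieBracket (𝓡 n) A.ξ X p) (Y p)
      - A.g.inner p (X p) (VectorField.mlieBracket (𝓡 n) A.ξ Y p) = 0

/-- An ST (Sasaki with torsion) structure: a normal almost contact metric structure whose Reeb
field is Killing. -/
structure IsST (A : AlmostContactMetric n M) : Prop where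
  normal : A.IsNormal
  killing : A.IsKillingReeb

/-- A quasi-Sasaki structure: a normal almost contact metric structure with closed fundamental
`2`-form. -/
structure IsQuasiSasaki (A : AlmostContactMetric n M) : Prop where
  normal : A.IsNormal
  closed : ∀ p : M, A.dF p = 0

/-- The torsion `3`-form `c = η ∧ dη + d^φ F`, where `d^φ F = dF(φ·, φ·, φ·)`. -/
def torsion (A : AlmostContactMetric n M) (p : M) (X Y Z : TangentSpace (𝓡 n) p) : ℝ :=
  wedgeOneTwo (fun U => A.η p ![U]) (fun U V => A.dη p ![U, V]) X Y Z
    + A.dF p ![A.φ p X, A.φ p Y, A.φ p Z]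

/-- `e` is an orthonormal basis of `T_pM` with respect to `g`. -/
def IsOrthonormalFrameAt (A : AlmostContactMetric n M) (p : M)
    (e : Fin n → TangentSpace (𝓡 n) p) : Prop :=
  ∀ i j, A.g.inner p (e i) (e j) = if i = j then 1 else 0

theorem sum_orthonormal_eq {V : Type*} [NormedAddCommGroup V] [InnerProductSpace ℝ V]
    [FiniteDimensional ℝ V] (hn : Module.finrank ℝ V = n) {e e' : Fin n → V}
    (he : Orthonormal ℝ e) (he' : Orthonormal ℝ e') (B : V →ₗ[ℝ] V →ₗ[ℝ] ℝ) :
    ∑ i, B (e i) (e i) = ∑ i, B (e' i) (e' i) := by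
  have hs : ∀ {f : Fin n → V}, Orthonormal ℝ f → ⊤ ≤ Submodule.span ℝ (Set.range f) := by
    intro f hf
    exact (hf.linearIndependent.span_eq_top_of_card_eq_finrank' (by simp [hn])).ge
  let b := OrthonormalBasis.mk he (hs he)
  let b' := OrthonormalBasis.mk he' (hs he')
  have hb : ∀ i, e i = b i := fun i => by simp [b]
  have hb' : ∀ i, e' i = b' i := fun i => by simp [b']
  simp only [hb, hb']
  calc ∑ i, B (b i) (b i) = ∑ i, ∑ j, inner ℝ (b' j) (b i) * B (b' j) (b i) := by
        refine Finset.sum_congr rfl fun i _ => ?_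
        conv_lhs => rw [← b'.sum_repr' (b i)]
        rw [b'.sum_repr' (b i)]
        conv_lhs => enter [1]; rw [← b'.sum_repr' (b i)]
        simp [map_sum, LinearMap.sum_apply]
    _ = ∑ j, ∑ i, inner ℝ (b' j) (b i) * B (b' j) (b i) := Finset.sum_comm
    _ = ∑ j, B (b' j) (b' j) := by
        refine Finset.sum_congr rfl fun j _ => ?_
        conv_rhs => enter [2]; rw [← b.sum_repr' (b' j)]
        simp [map_sum, real_inner_comm]

theorem exists_isOrthonormalFrameAt (A : AlmostContactMetric n M) (p : M) :
    ∃ e : Fin n → TangentSpace (𝓡 n) p, A.IsOrthonormalFrameAt p e := by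
  let core : InnerProductSpace.Core ℝ (TangentSpace (𝓡 n) p) := A.g.toRiemannianMetric.toCore p
  let _ : NormedAddCommGroup (TangentSpace (𝓡 n) p) := core.toNormedAddCommGroup
  let _ : InnerProductSpace ℝ (TangentSpace (𝓡 n) p) := InnerProductSpace.ofCore core.toCore
  have _ : FiniteDimensional ℝ (TangentSpace (𝓡 n) p) :=
    inferInstanceAs (FiniteDimensional ℝ (EuclideanSpace ℝ (Fin n)))
  have hn : Module.finrank ℝ (TangentSpace (𝓡 n) p) = n :=
    finrank_euclideanSpace_fin (𝕜 := ℝ) (n := n)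
  let b := (stdOrthonormalBasis ℝ (TangentSpace (𝓡 n) p)).reindex (finCongr hn)
  exact ⟨b, fun i j => orthonormal_iff_ite.mp b.orthonormal i j⟩

/-- An orthonormal basis of `T_pM`. -/
def orthonormalFrame (A : AlmostContactMetric n M) (p : M) : Fin n → TangentSpace (𝓡 n) p :=
  (A.exists_isOrthonormalFrameAt p).choose

/-- The Lee `1`-form `ϑ(X) = -1/2 ∑ᵢ c(φ(X), Eᵢ, φ(Eᵢ))`, for an orthonormal frame `E₁, …, Eₙ`.
The value does not depend on the frame, see `leeForm_eq`. -/
def leeForm (A : AlmostContactMetric n M) (p : M) (X : TangentSpace (𝓡 n) p) : ℝ :=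
  (-1 / 2) * ∑ i, A.torsion p (A.φ p X) (A.orthonormalFrame p i) (A.φ p (A.orthonormalFrame p i))

theorem leeForm_eq (A : AlmostContactMetric n M) (p : M) (X : TangentSpace (𝓡 n) p)
    {e : Fin n → TangentSpace (𝓡 n) p} (he : A.IsOrthonormalFrameAt p e) :
    A.leeForm p X = (-1 / 2) * ∑ i, A.torsion p (A.φ p X) (e i) (A.φ p (e i)) := by
  let core : InnerProductSpace.Core ℝ (TangentSpace (𝓡 n) p) := A.g.toRiemannianMetric.toCore p
  let _ : NormedAddCommGroup (TangentSpace (𝓡 n) p) := core.toNormedAddCommGroup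
  let _ : InnerProductSpace ℝ (TangentSpace (𝓡 n) p) := InnerProductSpace.ofCore core.toCore
  have _ : FiniteDimensional ℝ (TangentSpace (𝓡 n) p) :=
    inferInstanceAs (FiniteDimensional ℝ (EuclideanSpace ℝ (Fin n)))
  have hn : Module.finrank ℝ (TangentSpace (𝓡 n) p) = n :=
    finrank_euclideanSpace_fin (𝕜 := ℝ) (n := n)
  have u0 : ∀ a b x : TangentSpace (𝓡 n) p, Function.update ![a, b] 0 x = ![x, b] := by
    intro a b x; ext i : 1; fin_cases i <;> rfl
  have u1 : ∀ a b x : TangentSpace (𝓡 n) p, Function.update ![a, b] 1 x = ![a, x] := by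
    intro a b x; ext i : 1; fin_cases i <;> rfl
  have w1 : ∀ a b c x : TangentSpace (𝓡 n) p, Function.update ![a, b, c] 1 x = ![a, x, c] := by
    intro a b c x; ext i : 1; fin_cases i <;> rfl
  have w2 : ∀ a b c x : TangentSpace (𝓡 n) p, Function.update ![a, b, c] 2 x = ![a, b, x] := by
    intro a b c x; ext i : 1; fin_cases i <;> rfl
  have hη : ∀ x, A.η p ![x] = A.g.inner p (A.ξ p) x := fun x => rfl
  have hadd2 : ∀ U x y, A.dη p ![U, x + y] = A.dη p ![U, x] + A.dη p ![U, y] := fun U x y => by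
    have h := (A.dη p).map_update_add ![U, 0] 1 x y
    rwa [u1, u1, u1] at h
  have hadd1 : ∀ U x y, A.dη p ![x + y, U] = A.dη p ![x, U] + A.dη p ![y, U] := fun U x y => by
    have h := (A.dη p).map_update_add ![0, U] 0 x y
    rwa [u0, u0, u0] at h
  have hsmul2 : ∀ (c : ℝ) U x, A.dη p ![U, c • x] = c * A.dη p ![U, x] := fun c U x => by
    have h := (A.dη p).map_update_smul ![U, 0] 1 c x
    rwa [u1, u1] at h
  have hsmul1 : ∀ (c : ℝ) U x, A.dη p ![c • x, U] = c * A.dη p ![x, U] := fun c U x => by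
    have h := (A.dη p).map_update_smul ![0, U] 0 c x
    rwa [u0, u0] at h
  have haddF1 : ∀ U V x y, A.dF p ![U, x + y, V] = A.dF p ![U, x, V] + A.dF p ![U, y, V] :=
    fun U V x y => by
      have h := (A.dF p).map_update_add ![U, 0, V] 1 x y
      rwa [w1, w1, w1] at h
  have haddF2 : ∀ U V x y, A.dF p ![U, V, x + y] = A.dF p ![U, V, x] + A.dF p ![U, V, y] :=
    fun U V x y => by
      have h := (A.dF p).map_update_add ![U, V, 0] 2 x y
      rwa [w2, w2, w2] at h
  have hsmulF1 : ∀ (c : ℝ) U V x, A.dF p ![U, c • x, V] = c * A.dF p ![U, x, V] :=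
    fun c U V x => by
      have h := (A.dF p).map_update_smul ![U, 0, V] 1 c x
      rwa [w1, w1] at h
  have hsmulF2 : ∀ (c : ℝ) U V x, A.dF p ![U, V, c • x] = c * A.dF p ![U, V, x] :=
    fun c U V x => by
      have h := (A.dF p).map_update_smul ![U, V, 0] 2 c x
      rwa [w2, w2] at h
  let B : TangentSpace (𝓡 n) p →ₗ[ℝ] TangentSpace (𝓡 n) p →ₗ[ℝ] ℝ :=
    LinearMap.mk₂ ℝ (fun U V => A.torsion p (A.φ p X) U (A.φ p V))
      (fun x y V => by
        simp only [torsion, wedgeOneTwo, hη, map_add, hadd1, hadd2, haddF1]; ring)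
      (fun c x V => by
        simp only [torsion, wedgeOneTwo, hη, map_smul, hsmul1, hsmul2, hsmulF1, smul_eq_mul]; ring)
      (fun U x y => by
        simp only [torsion, wedgeOneTwo, hη, map_add, hadd1, hadd2, haddF2]; ring)
      (fun c U x => by
        simp only [torsion, wedgeOneTwo, hη, map_smul, hsmul1, hsmul2, hsmulF2, smul_eq_mul]; ring)
  have key := sum_orthonormal_eq hn
    (orthonormal_iff_ite.mpr fun i j => (A.exists_isOrthonormalFrameAt p).choose_spec i j)
    (orthonormal_iff_ite.mpr fun i j => he i j) B
  exact congrArg (fun t : ℝ => (-1 / 2) * t) key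

/-- The structure is balanced if its Lee form vanishes identically. -/
def IsBalanced (A : AlmostContactMetric n M) : Prop :=
  ∀ (p : M) (X : TangentSpace (𝓡 n) p), A.leeForm p X = 0

end AlmostContactMetric

end

/-! The identity `dF = ϑ ∧ F` is linear algebra at each point once `ι_ξ dF = 0` is known. Normality
with `ξ` in the first slot, together with the Killing condition, gives `[ξ, φY] = φ[ξ, Y]`
(`IsST.mlieBracket_ξ_φ`). So `ξ` preserves `g` and `φ`, hence `F`. Since also `ι_ξ F = 0`, the
bracket formula for `dF` gives `ι_ξ dF = 0` (`IsST.dF_ξ`).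

Thus `dF` lives on the 4-dimensional space `ξ^⊥`, where `F` is nondegenerate. There every 3-form `T`
is `α ∧ F`, with `α` the contraction of `T` with `F` (`AlternatingMap.eq_wedgeOneTwo_of_basis`). On
a frame `(ξ, u, φu, v, φv)` the `η ∧ dη` part of the torsion does not contribute to the Lee form,
and what remains is exactly `α` (`leeForm_eq_sum_dF`, `dF_eq_wedge_of_horizontal`).

The equivalence follows: `ϑ = 0` forces `dF = 0` by the identity, and `dF = 0` forces `ϑ = 0`
because `ϑ` is a trace of `dF`. -/

/-! ### Alternating 2- and 3-forms on a module. -/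

theorem Module.Basis.ext_alternating_of_strictMono {R M N ι : Type*} [CommRing R] [AddCommGroup M]
    [Module R M] [AddCommGroup N] [Module R N] [LinearOrder ι] {k : ℕ}
    {f g : M [⋀^Fin k]→ₗ[R] N} (b : Module.Basis ι R M)
    (h : ∀ v : Fin k → ι, StrictMono v → (f fun i => b (v i)) = g fun i => b (v i)) : f = g := by
  refine b.ext_alternating fun v hv => ?_
  -- Sorting an injective index tuple multiplies both values by the same sign, which can be
  -- cancelled.
  have hs : StrictMono (v ∘ Tuple.sort v) :=
    (Tuple.monotone_sort v).strictMono_of_injective (hv.comp (Tuple.sort v).injective)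
  have h1 := f.map_perm (fun i => b (v i)) (Tuple.sort v)
  have h2 := g.map_perm (fun i => b (v i)) (Tuple.sort v)
  have h3 := h _ hs
  have h4 : Equiv.Perm.sign (Tuple.sort v) • f (fun i => b (v i))
      = Equiv.Perm.sign (Tuple.sort v) • g (fun i => b (v i)) := by
    rw [← h1, ← h2]; exact h3
  have h5 := congrArg ((Equiv.Perm.sign (Tuple.sort v))⁻¹ • ·) h4
  simpa only [inv_smul_smul] using h5

namespace AlternatingMap

variable {R V N : Type*} [CommRing R] [AddCommGroup V] [Module R V] [AddCommGroup N] [Module R N]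

theorem vecTwo_add_left (β : V [⋀^Fin 2]→ₗ[R] N) (a b c : V) :
    β ![a + b, c] = β ![a, c] + β ![b, c] := β.map_vecCons_add ![c] a b

theorem vecTwo_smul_left (β : V [⋀^Fin 2]→ₗ[R] N) (r : R) (a c : V) :
    β ![r • a, c] = r • β ![a, c] := β.map_vecCons_smul ![c] r a

theorem vecTwo_swap (β : V [⋀^Fin 2]→ₗ[R] N) (a b : V) : β ![a, b] = -β ![b, a] := by
  rw [← β.map_swap ![b, a] (i := 0) (j := 1) (by simp)]
  congr 1; ext i; fin_cases i <;> rfl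

theorem vecTwo_self (β : V [⋀^Fin 2]→ₗ[R] N) (a : V) : β ![a, a] = 0 :=
  β.map_eq_zero_of_eq _ (i := 0) (j := 1) rfl (by simp)

theorem vecTwo_add_right (β : V [⋀^Fin 2]→ₗ[R] N) (a b c : V) :
    β ![c, a + b] = β ![c, a] + β ![c, b] := by
  rw [vecTwo_swap, vecTwo_add_left, vecTwo_swap β c a, vecTwo_swap β c b, neg_add]

theorem vecTwo_smul_right (β : V [⋀^Fin 2]→ₗ[R] N) (r : R) (a c : V) :
    β ![c, r • a] = r • β ![c, a] := by
  rw [vecTwo_swap, vecTwo_smul_left, vecTwo_swap β c a, smul_neg]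

theorem vecThree_swap₀₁ (T : V [⋀^Fin 3]→ₗ[R] N) (a b c : V) : T ![a, b, c] = -T ![b, a, c] := by
  rw [← T.map_swap ![b, a, c] (i := 0) (j := 1) (by simp)]
  congr 1; ext i; fin_cases i <;> rfl

theorem vecThree_swap₁₂ (T : V [⋀^Fin 3]→ₗ[R] N) (a b c : V) : T ![a, b, c] = -T ![a, c, b] := by
  rw [← T.map_swap ![a, c, b] (i := 1) (j := 2) (by simp)]
  congr 1; ext i; fin_cases i <;> rfl

theorem vecThree_self₁₂ (T : V [⋀^Fin 3]→ₗ[R] N) (a b : V) : T ![a, b, b] = 0 :=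
  T.map_eq_zero_of_eq _ (i := 1) (j := 2) rfl (by simp)

theorem vecThree_self₀₁ (T : V [⋀^Fin 3]→ₗ[R] N) (a b : V) : T ![a, a, b] = 0 :=
  T.map_eq_zero_of_eq _ (i := 0) (j := 1) rfl (by simp)

theorem vecThree_add₀ (T : V [⋀^Fin 3]→ₗ[R] N) (a b c d : V) :
    T ![a + b, c, d] = T ![a, c, d] + T ![b, c, d] := T.map_vecCons_add ![c, d] a b

theorem vecThree_smul₀ (T : V [⋀^Fin 3]→ₗ[R] N) (r : R) (a c d : V) :
    T ![r • a, c, d] = r • T ![a, c, d] := T.map_vecCons_smul ![c, d] r a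

theorem vecThree_neg₀ (T : V [⋀^Fin 3]→ₗ[R] N) (a c d : V) :
    T ![-a, c, d] = -T ![a, c, d] := by
  rw [← neg_one_smul R a, vecThree_smul₀, neg_one_smul]

theorem vecThree_neg₂ (T : V [⋀^Fin 3]→ₗ[R] N) (a c d : V) :
    T ![a, c, -d] = -T ![a, c, d] := by
  rw [vecThree_swap₁₂, vecThree_swap₀₁, vecThree_neg₀, vecThree_swap₀₁ T d, vecThree_swap₁₂ T a d]
  simp

theorem vecTwo_zero_left (β : V [⋀^Fin 2]→ₗ[R] N) (a : V) : β ![0, a] = 0 :=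
  β.map_coord_zero (m := ![0, a]) 0 rfl

theorem vecThree_zero₂ (T : V [⋀^Fin 3]→ₗ[R] N) (a b : V) : T ![a, b, 0] = 0 :=
  T.map_coord_zero (m := ![a, b, 0]) 2 rfl

/-- The wedge product of a linear form and an alternating `2`-form. -/
def wedgeOneTwo (α : V →ₗ[R] R) (β : V [⋀^Fin 2]→ₗ[R] R) : V [⋀^Fin 3]→ₗ[R] R where
  toFun v := α (v 0) * β ![v 1, v 2] + α (v 1) * β ![v 2, v 0] + α (v 2) * β ![v 0, v 1]
  map_update_add' {inst} v i x y := by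
    -- The field quantifies over an arbitrary decidability instance; fixing the standard one lets
    -- `simp` evaluate `Function.update`.
    cases Subsingleton.elim inst (instDecidableEqFin 3)
    obtain rfl | rfl | rfl : i = 0 ∨ i = 1 ∨ i = 2 := by fin_cases i <;> simp
    all_goals simp [vecTwo_add_left, vecTwo_add_right]; ring
  map_update_smul' {inst} v i r x := by
    cases Subsingleton.elim inst (instDecidableEqFin 3)
    obtain rfl | rfl | rfl : i = 0 ∨ i = 1 ∨ i = 2 := by fin_cases i <;> simp
    all_goals simp [vecTwo_smul_left, vecTwo_smul_right]; ring
  map_eq_zero_of_eq' v i j h hij := by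
    have key : v 0 = v 1 ∨ v 1 = v 2 ∨ v 0 = v 2 := by
      fin_cases i <;> fin_cases j <;> simp_all
    rcases key with h | h | h
    · rw [h, vecTwo_self, vecTwo_swap β (v 2)]; ring
    · rw [h, vecTwo_self, vecTwo_swap β (v 0)]; ring
    · rw [h, vecTwo_self, vecTwo_swap β (v 2)]; ring

theorem wedgeOneTwo_apply (α : V →ₗ[R] R) (β : V [⋀^Fin 2]→ₗ[R] R) (v : Fin 3 → V) :
    wedgeOneTwo α β v =
      α (v 0) * β ![v 1, v 2] + α (v 1) * β ![v 2, v 0] + α (v 2) * β ![v 0, v 1] := rfl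

/-- Each triple from `{1, 2, 3, 4}` contains exactly one of the pairs `{1, 2}`, `{3, 4}`. On it,
only the term of `α ∧ β` pairing those two indices survives, and `α` at the remaining index is the
value of `T` up to a cyclic shift. Triples containing `0` give zero on both sides. -/
theorem eq_wedgeOneTwo_of_basis (T : V [⋀^Fin 3]→ₗ[R] R) (β : V [⋀^Fin 2]→ₗ[R] R)
    (α : V →ₗ[R] R) (e : Module.Basis (Fin 5) R V) (hT : ∀ Y Z, T ![e 0, Y, Z] = 0)
    (hβ : ∀ Y, β ![e 0, Y] = 0) (h12 : β ![e 1, e 2] = 1) (h34 : β ![e 3, e 4] = 1)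
    (h13 : β ![e 1, e 3] = 0) (h14 : β ![e 1, e 4] = 0) (h23 : β ![e 2, e 3] = 0)
    (h24 : β ![e 2, e 4] = 0) (hα : ∀ X, α X = T ![X, e 1, e 2] + T ![X, e 3, e 4]) :
    T = wedgeOneTwo α β := by
  refine e.ext_alternating_of_strictMono fun w hw => ?_
  have h01 : w 0 < w 1 := hw (by decide)
  have h12' : w 1 < w 2 := hw (by decide)
  have hw3 : (fun i => e (w i)) = ![e (w 0), e (w 1), e (w 2)] := by
    ext i : 1; fin_cases i <;> rfl
  have cases5 : ∀ i j k : Fin 5, i < j → j < k → i = 0 ∨ (i = 1 ∧ j = 2 ∧ k = 3) ∨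
      (i = 1 ∧ j = 2 ∧ k = 4) ∨ (i = 1 ∧ j = 3 ∧ k = 4) ∨ (i = 2 ∧ j = 3 ∧ k = 4) := by decide
  have s := β.vecTwo_swap
  have cyc : ∀ a b c, T ![a, b, c] = T ![c, a, b] := fun a b c => by
    rw [T.vecThree_swap₁₂, T.vecThree_swap₀₁, neg_neg]
  rw [hw3, wedgeOneTwo_apply]
  simp only [Matrix.cons_val]
  rcases cases5 _ _ _ h01 h12' with h | ⟨h, h', h''⟩ | ⟨h, h', h''⟩ | ⟨h, h', h''⟩ | ⟨h, h', h''⟩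
  · rw [h, hT, hα, hT, hT, s _ (e 0), hβ, hβ]; ring
  all_goals simp only [h, h', h'', hα]
  · rw [h12, h23, s (e 3) (e 1), h13, T.vecThree_self₀₁ (e 3), cyc (e 1) (e 2)]; ring
  · rw [h12, h24, s (e 4) (e 1), h14, cyc (e 4) (e 3), T.vecThree_self₀₁ (e 4), cyc (e 1) (e 2)]; ring
  · rw [h34, h13, s (e 4) (e 1), h14, T.vecThree_self₀₁]; ring
  · rw [h34, h23, s (e 4) (e 2), h24, cyc (e 2) (e 1), cyc (e 2) (e 2), T.vecThree_self₁₂]; ring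

end AlternatingMap

/-! ### Adapted frames and the Lee form at a point. -/

namespace AlmostContactMetric

variable {n : ℕ} {M : Type*} [TopologicalSpace M]
  [ChartedSpace (EuclideanSpace ℝ (Fin n)) M] [IsManifold (𝓡 n) ∞ M]

theorem inner_φ_left (A : AlmostContactMetric n M) (p : M) (X Y : TangentSpace (𝓡 n) p) :
    A.g.inner p (A.φ p X) Y = -A.g.inner p X (A.φ p Y) := by
  have h := A.inner_φ_self p (X + Y)
  simp only [map_add, add_apply, A.inner_φ_self] at h
  rw [A.g.symm p X]
  linarith

omit [IsManifold (𝓡 n) ∞ M] in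
theorem finrank_tangentSpace (p : M) : Module.finrank ℝ (TangentSpace (𝓡 n) p) = n :=
  finrank_euclideanSpace_fin (𝕜 := ℝ) (n := n)

/-- Fewer than `n` linear forms have a common nonzero zero, which is then normalized. -/
theorem exists_unit_orthogonal (A : AlmostContactMetric n M) (p : M) {k : ℕ} (hk : k < n)
    (w : Fin k → TangentSpace (𝓡 n) p) :
    ∃ v, A.g.inner p v v = 1 ∧ ∀ i, A.g.inner p (w i) v = 0 := by
  have _ : FiniteDimensional ℝ (TangentSpace (𝓡 n) p) :=
    inferInstanceAs (FiniteDimensional ℝ (EuclideanSpace ℝ (Fin n)))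
  let f : TangentSpace (𝓡 n) p →ₗ[ℝ] (Fin k → ℝ) :=
    LinearMap.pi fun i => (A.g.inner p (w i)).toLinearMap
  have hf : LinearMap.ker f ≠ ⊥ := LinearMap.ker_ne_bot_of_finrank_lt (by
    rw [finrank_tangentSpace]; simpa using hk)
  obtain ⟨v, hv, hv0⟩ := (Submodule.ne_bot_iff _).mp hf
  have hpos := A.g.pos p v hv0
  refine ⟨(Real.sqrt (A.g.inner p v v))⁻¹ • v, ?_, fun i => ?_⟩
  · simp only [map_smul, smul_apply, smul_eq_mul]
    have hs := Real.mul_self_sqrt hpos.le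
    have hs0 : Real.sqrt (A.g.inner p v v) ≠ 0 := (Real.sqrt_pos.mpr hpos).ne'
    field_simp
    rw [sq, hs]
  · have : A.g.inner p (w i) v = 0 := congrFun (LinearMap.mem_ker.mp hv) i
    rw [map_smul, this, smul_zero]

theorem IsOrthonormalFrameAt.linearIndependent {A : AlmostContactMetric n M} {p : M}
    {e : Fin n → TangentSpace (𝓡 n) p} (he : A.IsOrthonormalFrameAt p e) :
    LinearIndependent ℝ e := by
  rw [Fintype.linearIndependent_iff]
  intro c hc i
  have h := congrArg (A.g.inner p (e i)) hc
  simpa [map_sum, he i] using h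

/-- A frame `(ξ, e₁, φ e₁, e₃, φ e₃)`, orthonormal at `p`. -/
theorem exists_adapted_frame {M : Type*} [TopologicalSpace M]
    [ChartedSpace (EuclideanSpace ℝ (Fin 5)) M] [IsManifold (𝓡 5) ∞ M]
    (A : AlmostContactMetric 5 M) (p : M) :
    ∃ u v : TangentSpace (𝓡 5) p,
      A.IsOrthonormalFrameAt p ![A.ξ p, u, A.φ p u, v, A.φ p v] := by
  obtain ⟨u, hu, huξ⟩ := A.exists_unit_orthogonal p (k := 1) (by norm_num) ![A.ξ p]
  obtain ⟨v, hv, hvw⟩ := A.exists_unit_orthogonal p (k := 3) (by norm_num) ![A.ξ p, u, A.φ p u]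
  have h1 : A.g.inner p (A.ξ p) u = 0 := huξ 0
  have h2 : A.g.inner p (A.ξ p) v = 0 := hvw 0
  have h3 : A.g.inner p u v = 0 := hvw 1
  have h4 : A.g.inner p (A.φ p u) v = 0 := hvw 2
  -- `φ` is skew, so `v ⊥ φu` already gives `φv ⊥ u`; this is why `v` was chosen orthogonal to `φu`
  -- as well.
  have h5 : A.g.inner p u (A.φ p v) = 0 := by
    have := A.inner_φ_left p u v; linarith
  have h6 : A.g.inner p (A.φ p v) u = 0 := by rw [A.g.symm, h5]
  have s := A.g.symm p
  refine ⟨u, v, fun i j => ?_⟩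
  fin_cases i <;> fin_cases j <;>
    simp [A.unit_ξ, A.η_φ, hu, hv, h1, h2, h3, h4, h5, h6, A.inner_φ_self, A.compat,
      s _ (A.ξ p), s v u, s v (A.φ p u), s _ (A.φ p v), s u (A.φ p u)]

/-- For frame vectors that are `ξ` or horizontal, `η ∧ dη` vanishes on `(φX, E, φE)` term by term.
For horizontal `E`, horizontality of `dF` and `φ² = -1 + η ⊗ ξ` turn `dF(φ²X, φE, φ²E)` into `dF(X,
φE, E)`; the swap back to `dF(X, E, φE)` accounts for the change from `-1/2` to `1/2`. -/
theorem leeForm_eq_sum_dF (A : AlmostContactMetric n M) (p : M)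
    (hξ : ∀ Y Z, A.dF p ![A.ξ p, Y, Z] = 0) (X : TangentSpace (𝓡 n) p)
    {e : Fin n → TangentSpace (𝓡 n) p} (he : A.IsOrthonormalFrameAt p e)
    (he' : ∀ i, e i = A.ξ p ∨ A.g.inner p (A.ξ p) (e i) = 0) :
    A.leeForm p X = 1 / 2 * ∑ i, A.dF p ![X, e i, A.φ p (e i)] := by
  rw [A.leeForm_eq p X he, Finset.mul_sum, Finset.mul_sum]
  refine Finset.sum_congr rfl fun i _ => ?_
  let T := (A.dF p).toAlternatingMap
  change -1 / 2 * A.torsion p (A.φ p X) (e i) (A.φ p (e i)) = 1 / 2 * T ![X, e i, A.φ p (e i)]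
  have hη : ∀ x, A.η p ![x] = A.g.inner p (A.ξ p) x := fun x => rfl
  have hηφ : ∀ x, A.η p ![A.φ p x] = 0 := A.η_φ p
  have hT : ∀ Y Z, T ![A.ξ p, Y, Z] = 0 := hξ
  have ht : ∀ Y Z W, A.torsion p Y Z W = wedgeOneTwo (fun U => A.η p ![U])
      (fun U V => (A.dη p).toAlternatingMap ![U, V]) Y Z W
      + T ![A.φ p Y, A.φ p Z, A.φ p W] := fun _ _ _ => rfl
  rw [ht]
  rcases he' i with h | h
  · rw [h, A.φ_ξ, map_zero, T.vecThree_self₁₂]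
    rw [T.vecThree_zero₂]
    simp only [wedgeOneTwo, hηφ]
    rw [AlternatingMap.vecTwo_zero_left, show A.η p ![0] = 0 from map_zero (A.g.inner p (A.ξ p))]
    ring
  · simp only [wedgeOneTwo, hηφ, hη, h]
    rw [A.φ_sq, A.φ_sq, h, T.vecThree_add₀, T.vecThree_smul₀, hT, T.vecThree_neg₀, zero_smul,
      add_zero, T.vecThree_neg₂, T.vecThree_swap₁₂]
    simp
    ring

theorem dF_eq_wedge_of_horizontal {M : Type*} [TopologicalSpace M]
    [ChartedSpace (EuclideanSpace ℝ (Fin 5)) M] [IsManifold (𝓡 5) ∞ M]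
    (A : AlmostContactMetric 5 M) (p : M) (hξ : ∀ Y Z, A.dF p ![A.ξ p, Y, Z] = 0)
    (X Y Z : TangentSpace (𝓡 5) p) :
    A.dF p ![X, Y, Z] = wedgeOneTwo (A.leeForm p) (fun U V => A.F p ![U, V]) X Y Z := by
  obtain ⟨u, v, he⟩ := A.exists_adapted_frame p
  have hu : A.g.inner p (A.ξ p) u = 0 := he 0 1
  have hv : A.g.inner p (A.ξ p) v = 0 := he 0 3
  let T := (A.dF p).toAlternatingMap
  have hT : ∀ Y Z, T ![A.ξ p, Y, Z] = 0 := hξ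
  have hφu : A.φ p (A.φ p u) = -u := by rw [A.φ_sq, hu, zero_smul, add_zero]
  have hφv : A.φ p (A.φ p v) = -v := by rw [A.φ_sq, hv, zero_smul, add_zero]
  let α : TangentSpace (𝓡 5) p →ₗ[ℝ] ℝ :=
    { toFun := fun X => T ![X, u, A.φ p u] + T ![X, v, A.φ p v]
      map_add' := fun a b => by rw [T.vecThree_add₀, T.vecThree_add₀]; ring
      map_smul' := fun r a => by
        rw [T.vecThree_smul₀, T.vecThree_smul₀]; simp only [smul_eq_mul, RingHom.id_apply]; ring }
  have hα : ∀ X, A.leeForm p X = α X := fun X => by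
    rw [A.leeForm_eq_sum_dF p hξ X he fun i => by
      fin_cases i <;> simp [hu, hv, A.η_φ]]
    -- The frame vectors `u` and `φu` contribute equally, as do `v` and `φv`, which absorbs the
    -- factor `1/2`; `ξ` contributes nothing.
    change 1 / 2 * ∑ i, T _ = T ![X, u, A.φ p u] + T ![X, v, A.φ p v]
    simp only [Fin.sum_univ_five, Matrix.cons_val, A.φ_ξ, hφu, hφv]
    rw [T.vecThree_zero₂, T.vecThree_neg₂, T.vecThree_neg₂,
      T.vecThree_swap₁₂ X (A.φ p u), T.vecThree_swap₁₂ X (A.φ p v)]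
    ring
  have _ : FiniteDimensional ℝ (TangentSpace (𝓡 5) p) :=
    inferInstanceAs (FiniteDimensional ℝ (EuclideanSpace ℝ (Fin 5)))
  let b := basisOfLinearIndependentOfCardEqFinrank he.linearIndependent
    (by rw [finrank_tangentSpace]; simp)
  have hb : ∀ i, b i = ![A.ξ p, u, A.φ p u, v, A.φ p v] i := fun i => by simp [b]
  have hF : ∀ U V, (A.F p).toAlternatingMap ![U, V] = A.g.inner p (A.φ p U) V := fun _ _ => rfl
  have main : T = AlternatingMap.wedgeOneTwo α (A.F p).toAlternatingMap := by
    refine AlternatingMap.eq_wedgeOneTwo_of_basis T _ α b ?_ ?_ ?_ ?_ ?_ ?_ ?_ ?_ ?_ <;>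
      simp only [hb, hF, Matrix.cons_val, hT, A.φ_ξ, map_zero, zero_apply, implies_true, hφu]
    · exact he 2 2
    · exact he 4 4
    · exact he 2 3
    · exact he 2 4
    · rw [map_neg, neg_apply, show A.g.inner p u v = 0 from he 1 3, neg_zero]
    · rw [map_neg, neg_apply, show A.g.inner p u (A.φ p v) = 0 from he 1 4, neg_zero]
    · exact fun X => rfl
  have h := congrArg (fun S => S ![X, Y, Z]) main
  simp only [_root_.wedgeOneTwo, hα]
  exact h

end AlmostContactMetric

/-! ### Exterior derivative and Lie brackets on a normed space. -/

/-- Evaluation on tuples of basis vectors embeds the forms linearly into a finite-dimensional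
coordinate space; a left inverse recovers `θ` from its differentiable coordinates. -/
theorem differentiableAt_continuousAlternatingMap_of_apply {E V : Type*} [NormedAddCommGroup E]
    [NormedSpace ℝ E] [NormedAddCommGroup V] [NormedSpace ℝ V] [FiniteDimensional ℝ V] {k : ℕ}
    {θ : E → V [⋀^Fin k]→L[ℝ] ℝ} {x : E}
    (h : ∀ v : Fin k → V, DifferentiableAt ℝ (fun y => θ y v) x) : DifferentiableAt ℝ θ x := by
  let b := Module.finBasis ℝ V
  let ev : (V [⋀^Fin k]→L[ℝ] ℝ) →ₗ[ℝ] ((Fin k → Fin (Module.finrank ℝ V)) → ℝ) :=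
    LinearMap.pi fun w => (ContinuousAlternatingMap.apply ℝ V ℝ fun i => b (w i)).toLinearMap
  have hinj : LinearMap.ker ev = ⊥ := by
    refine LinearMap.ker_eq_bot.mpr fun α β hαβ => ?_
    apply ContinuousAlternatingMap.toAlternatingMap_injective
    exact b.ext_alternating fun w _ => congrFun hαβ w
  obtain ⟨L, hL⟩ := LinearMap.exists_leftInverse_of_injective ev hinj
  have h1 : θ = fun y => L.toContinuousLinearMap (ev (θ y)) := by
    funext y
    exact (LinearMap.congr_fun hL (θ y)).symm
  rw [h1]
  refine L.toContinuousLinearMap.differentiableAt.comp x ?_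
  exact differentiableAt_pi.mpr fun w => h _

/-- The invariant formula for the exterior derivative of a `2`-form on a normed space. -/
theorem extDeriv_apply_vectorField_two {E : Type*} [NormedAddCommGroup E] [NormedSpace ℝ E]
    {θ : E → E [⋀^Fin 2]→L[ℝ] ℝ} {X Y Z : E → E} {x : E} (hθ : DifferentiableAt ℝ θ x)
    (hX : DifferentiableAt ℝ X x) (hY : DifferentiableAt ℝ Y x) (hZ : DifferentiableAt ℝ Z x) :
    extDeriv θ x ![X x, Y x, Z x]
      = fderiv ℝ (fun y => θ y ![Y y, Z y]) x (X x) - fderiv ℝ (fun y => θ y ![X y, Z y]) x (Y x)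
        + fderiv ℝ (fun y => θ y ![X y, Y y]) x (Z x)
        - θ x ![VectorField.lieBracket ℝ X Y x, Z x] + θ x ![VectorField.lieBracket ℝ X Z x, Y x]
        - θ x ![VectorField.lieBracket ℝ Y Z x, X x] := by
  have hW : ∀ i, DifferentiableAt ℝ ((![X, Y, Z] : Fin 3 → E → E) i) x := by
    intro i
    fin_cases i
    exacts [hX, hY, hZ]
  have r : ∀ y, (fun i => (![X, Y, Z] : Fin 3 → E → E) i y) = ![X y, Y y, Z y] := by
    intro y; ext i : 1; fin_cases i <;> rfl
  have r0 : ∀ a b c : E, (0 : Fin 3).removeNth ![a, b, c] = ![b, c] := by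
    intro a b c; ext i : 1; fin_cases i <;> rfl
  have r1 : ∀ a b c : E, (1 : Fin 3).removeNth ![a, b, c] = ![a, c] := by
    intro a b c; ext i : 1; fin_cases i <;> rfl
  have r2 : ∀ a b c : E, (2 : Fin 3).removeNth ![a, b, c] = ![a, b] := by
    intro a b c; ext i : 1; fin_cases i <;> rfl
  -- The second index of the bracket sum is shifted by one: `(i, j)` with `i ≤ j` stands for the
  -- bracket of fields `i` and `j + 1`.
  have i0 : Finset.Ici (0 : Fin 2) = {0, 1} := by decide
  have i1 : Finset.Ici (1 : Fin 2) = {1} := by decide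
  have key := extDeriv_apply_vectorField hθ hW
  change extDeriv θ x (fun i => (![X, Y, Z] : Fin 3 → E → E) i x) = (∑ i : Fin 3, _) -
    ∑ i : Fin 2, ∑ j ∈ Finset.Ici (i : Fin 2), _ at key
  rw [Fin.sum_univ_three, Fin.sum_univ_two, i0, i1, Finset.sum_pair (by decide),
    Finset.sum_singleton] at key
  simp only [r, r0, r1, r2] at key
  have t0 : (0 : Fin 2).removeNth ((0 : Fin 2).castSucc.removeNth ![X x, Y x, Z x]) = ![Z x] := by
    ext i : 1; fin_cases i; rfl
  have t1 : (1 : Fin 2).removeNth ((0 : Fin 2).castSucc.removeNth ![X x, Y x, Z x]) = ![Y x] := by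
    ext i : 1; fin_cases i; rfl
  have t2 : (1 : Fin 2).removeNth ((1 : Fin 2).castSucc.removeNth ![X x, Y x, Z x]) = ![X x] := by
    ext i : 1; fin_cases i; rfl
  rw [t0, t1, t2] at key
  rw [key]
  simp [pow_two]
  ring

/-! ### Transfer of the bracket formula to manifolds through the chart at `p`. -/

section Chart

variable {n : ℕ} {M : Type*} [TopologicalSpace M]
  [ChartedSpace (EuclideanSpace ℝ (Fin n)) M] [IsManifold (𝓡 n) ∞ M]

/-- Normality and the Killing condition are tested on global smooth fields, so a tangent vector must
be extended globally: a local extension is cut off by a bump function, which is where the Hausdorff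
property enters. -/
theorem exists_contMDiffSection_eq [T2Space M] (p : M) (v : TangentSpace (𝓡 n) p) :
    ∃ Y : ContMDiffSection (𝓡 n) (EuclideanSpace ℝ (Fin n)) ∞
      (fun p : M => TangentSpace (𝓡 n) p), Y p = v := by
  obtain ⟨s, hs, h⟩ := FiberBundle.exists_contMDiffOn_extend (𝓡 n) (k := ∞)
    (EuclideanSpace ℝ (Fin n)) (V := fun p : M => TangentSpace (𝓡 n) p) v
  obtain ⟨u, hus, hu, hpu⟩ := mem_nhds_iff.mp hs
  obtain ⟨f, -, hf⟩ := (SmoothBumpFunction.nhds_basis_tsupport (I := 𝓡 n) p).mem_iff.mp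
    (hu.mem_nhds hpu)
  refine ⟨⟨_, ContMDiffOn.smul_section_of_tsupport f.contMDiff.contMDiffOn hu hf (h.mono hus)⟩, ?_⟩
  change f p • FiberBundle.extend (EuclideanSpace ℝ (Fin n)) v p = v
  rw [f.eq_one, one_smul, FiberBundle.extend_apply_self]

/-- A vector field is differentiable at `p` as a section of the tangent bundle. -/
abbrev MDifferentiableFieldAt (V : ∀ q : M, TangentSpace (𝓡 n) q) (p : M) : Prop :=
  MDifferentiableAt (𝓡 n) ((𝓡 n).prod 𝓘(ℝ, EuclideanSpace ℝ (Fin n)))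
    (fun q => (⟨q, V q⟩ : TangentBundle (𝓡 n) M)) p

/-- The representative in the chart at `p` of a vector field. -/
noncomputable def chartVectorField (p : M) (V : ∀ q : M, TangentSpace (𝓡 n) q) :
    EuclideanSpace ℝ (Fin n) → EuclideanSpace ℝ (Fin n) :=
  VectorField.mpullbackWithin 𝓘(ℝ, EuclideanSpace ℝ (Fin n)) (𝓡 n) (extChartAt (𝓡 n) p).symm V
    (Set.range (𝓡 n))

/-- The representative in the chart at `p` of a differential form. -/
noncomputable def chartForm {k : ℕ} (p : M)
    (θ : ∀ q : M, TangentSpace (𝓡 n) q [⋀^Fin k]→L[ℝ] ℝ) (y : EuclideanSpace ℝ (Fin n)) :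
    EuclideanSpace ℝ (Fin n) [⋀^Fin k]→L[ℝ] ℝ :=
  (θ ((extChartAt (𝓡 n) p).symm y)).compContinuousLinearMap
    (mfderiv (𝓡 n) (𝓡 n) (extChartAt (𝓡 n) p).symm y)

theorem mfderiv_extChartAt_symm_chartVectorField {p : M} (V : ∀ q : M, TangentSpace (𝓡 n) q)
    {y : EuclideanSpace ℝ (Fin n)} (hy : y ∈ (extChartAt (𝓡 n) p).target) :
    mfderiv (𝓡 n) (𝓡 n) (extChartAt (𝓡 n) p).symm y (chartVectorField p V y)
      = V ((extChartAt (𝓡 n) p).symm y) := by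
  have h := isInvertible_mfderivWithin_extChartAt_symm (I := 𝓡 n) hy
  have h2 := h.self_apply_inverse (V ((extChartAt (𝓡 n) p).symm y))
  rw [ModelWithCorners.range_eq_univ, mfderivWithin_univ] at h2
  unfold chartVectorField
  rw [ModelWithCorners.range_eq_univ, VectorField.mpullbackWithin_univ]
  exact h2

theorem chartForm_chartVectorField {k : ℕ} {p : M}
    (θ : ∀ q : M, TangentSpace (𝓡 n) q [⋀^Fin k]→L[ℝ] ℝ)
    (V : Fin k → ∀ q : M, TangentSpace (𝓡 n) q)
    {y : EuclideanSpace ℝ (Fin n)} (hy : y ∈ (extChartAt (𝓡 n) p).target) :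
    chartForm p θ y (fun i => chartVectorField p (V i) y)
      = θ ((extChartAt (𝓡 n) p).symm y) fun i => V i ((extChartAt (𝓡 n) p).symm y) := by
  change θ _ (fun i => mfderiv (𝓡 n) (𝓡 n) (extChartAt (𝓡 n) p).symm y
    (chartVectorField p (V i) y)) = _
  congr 1
  funext i
  exact mfderiv_extChartAt_symm_chartVectorField (V i) hy

theorem mfderiv_extChartAt_symm_self (p : M) (v : EuclideanSpace ℝ (Fin n)) :
    mfderiv (𝓡 n) (𝓡 n) (extChartAt (𝓡 n) p).symm (extChartAt (𝓡 n) p p) v = v := by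
  have h := mfderivWithin_range_extChartAt_symm (I := 𝓡 n) (x := p)
  rw [ModelWithCorners.range_eq_univ, mfderivWithin_univ] at h
  exact congrArg (fun L : EuclideanSpace ℝ (Fin n) →L[ℝ] EuclideanSpace ℝ (Fin n) => L v) h

theorem chartVectorField_self (p : M) (V : ∀ q : M, TangentSpace (𝓡 n) q) :
    chartVectorField p V (extChartAt (𝓡 n) p p) = V p := by
  have h := mfderiv_extChartAt_symm_chartVectorField V (mem_extChartAt_target (I := 𝓡 n) p)
  have h2 : V ((extChartAt (𝓡 n) p).symm (extChartAt (𝓡 n) p p))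
      = (V p : EuclideanSpace ℝ (Fin n)) := by rw [extChartAt_to_inv]
  exact (mfderiv_extChartAt_symm_self p _).symm.trans (h.trans h2)

theorem chartForm_self {k : ℕ} (p : M) (θ : ∀ q : M, TangentSpace (𝓡 n) q [⋀^Fin k]→L[ℝ] ℝ)
    (v : Fin k → TangentSpace (𝓡 n) p) :
    chartForm p θ (extChartAt (𝓡 n) p p) v = θ p v := by
  -- All tangent spaces are definitionally the model space, so one tuple `w` can be fed to `θ` at
  -- both points although their equality is only propositional.
  have h : ∀ (q : M) (_ : q = p) (w : Fin k → EuclideanSpace ℝ (Fin n)), θ q w = θ p w := by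
    rintro q rfl w
    rfl
  refine Eq.trans ?_ (h _ (extChartAt_to_inv (I := 𝓡 n) p) v)
  exact congrArg (θ _) (funext fun i => mfderiv_extChartAt_symm_self p (v i))

theorem mlieBracket_eq_lieBracket_chartVectorField (p : M) (V W : ∀ q : M, TangentSpace (𝓡 n) q) :
    VectorField.mlieBracket (𝓡 n) V W p = VectorField.lieBracket ℝ (chartVectorField p V)
      (chartVectorField p W) (extChartAt (𝓡 n) p p) := by
  rw [← VectorField.mlieBracketWithin_univ, VectorField.mlieBracketWithin_apply,
    mfderiv_extChartAt_self, Set.preimage_univ, Set.univ_inter]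
  change ContinuousLinearMap.inverse (ContinuousLinearMap.id ℝ (EuclideanSpace ℝ (Fin n))) _ = _
  rw [ContinuousLinearMap.inverse_id]
  change VectorField.lieBracketWithin ℝ (chartVectorField p V) (chartVectorField p W) _ _ = _
  rw [ModelWithCorners.range_eq_univ, VectorField.lieBracketWithin_univ]

theorem differentiableAt_chartVectorField {p : M} {V : ∀ q : M, TangentSpace (𝓡 n) q}
    (hV : MDifferentiableFieldAt V p) :
    DifferentiableAt ℝ (chartVectorField p V) (extChartAt (𝓡 n) p p) := by
  have : IsManifold (𝓡 n) 2 M := inferInstance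
  have h := (mdifferentiableWithinAt_univ.mpr
    hV).differentiableWithinAt_mpullbackWithin_vectorField
  rw [Set.preimage_univ, Set.univ_inter, ModelWithCorners.range_eq_univ] at h
  unfold chartVectorField
  rw [ModelWithCorners.range_eq_univ]
  exact h.differentiableAt Filter.univ_mem

omit [IsManifold (𝓡 n) ∞ M] in
theorem differentiableAt_comp_extChartAt_symm {p : M} {f : M → ℝ} (hf : MDifferentiableAt (𝓡 n) 𝓘(ℝ, ℝ) f p) :
    DifferentiableAt ℝ (f ∘ (extChartAt (𝓡 n) p).symm) (extChartAt (𝓡 n) p p) := by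
  have h := hf.differentiableWithinAt_writtenInExtChartAt
  rw [ModelWithCorners.range_eq_univ] at h
  exact h.differentiableAt Filter.univ_mem

omit [IsManifold (𝓡 n) ∞ M] in
theorem dirDeriv_eq_fderiv {p : M} {f : M → ℝ} (hf : MDifferentiableAt (𝓡 n) 𝓘(ℝ, ℝ) f p) (v : TangentSpace (𝓡 n) p) :
    AlmostContactMetric.dirDeriv f p v
      = fderiv ℝ (f ∘ (extChartAt (𝓡 n) p).symm) (extChartAt (𝓡 n) p p) v := by
  unfold AlmostContactMetric.dirDeriv
  rw [hf.mfderiv, ModelWithCorners.range_eq_univ, fderivWithin_univ]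
  rfl

/-- The local extension is built from the trivialization at `p`, so it is the constant field `v`
read in the chart. Coefficients of a form in the chart are therefore its values on such extensions.
-/
theorem extend_eq_mfderiv_extChartAt_symm {p : M} (v : TangentSpace (𝓡 n) p)
    {y : EuclideanSpace ℝ (Fin n)} (hy : y ∈ (extChartAt (𝓡 n) p).target) :
    FiberBundle.extend (EuclideanSpace ℝ (Fin n)) v ((extChartAt (𝓡 n) p).symm y)
      = mfderiv (𝓡 n) (𝓡 n) (extChartAt (𝓡 n) p).symm y v := by
  have hq : (extChartAt (𝓡 n) p).symm y ∈ (chartAt (EuclideanSpace ℝ (Fin n)) p).source := by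
    simpa using (extChartAt (𝓡 n) p).map_target hy
  have h := TangentBundle.symmL_trivializationAt (I := 𝓡 n) hq
  rw [ModelWithCorners.range_eq_univ, mfderivWithin_univ, (extChartAt (𝓡 n) p).right_inv hy] at h
  have h2 := TangentBundle.continuousLinearMapAt_trivializationAt (I := 𝓡 n) (x := p) (x₀ := p)
    (mem_chart_source _ p)
  rw [mfderiv_extChartAt_self] at h2
  have h3 : (trivializationAt (EuclideanSpace ℝ (Fin n)) (TangentSpace (𝓡 n)) p ⟨p, v⟩).2 = v := by
    have h4 := congrArg (fun L : TangentSpace (𝓡 n) p →L[ℝ] EuclideanSpace ℝ (Fin n) => L v) h2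
    rw [Trivialization.continuousLinearMapAt_apply, Trivialization.coe_linearMapAt_of_mem] at h4
    · exact h4
    · exact FiberBundle.mem_baseSet_trivializationAt' p
  have h5 := congrArg (fun L : EuclideanSpace ℝ (Fin n) →L[ℝ] EuclideanSpace ℝ (Fin n) => L v) h
  unfold FiberBundle.extend
  rw [h3]
  exact (Trivialization.symmL_apply (F := EuclideanSpace ℝ (Fin n)) (E := TangentSpace (𝓡 n))
    (trivializationAt (EuclideanSpace ℝ (Fin n)) (TangentSpace (𝓡 n)) p)
    (b := (extChartAt (𝓡 n) p).symm y) hq v).symm.trans h5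

theorem differentiableAt_chartForm {k : ℕ} {p : M}
    {θ : ∀ q : M, TangentSpace (𝓡 n) q [⋀^Fin k]→L[ℝ] ℝ}
    (hθ : ∀ v : Fin k → TangentSpace (𝓡 n) p,
      MDifferentiableAt (𝓡 n) 𝓘(ℝ, ℝ) (fun q => θ q fun i => FiberBundle.extend (EuclideanSpace ℝ (Fin n)) (v i) q) p) :
    DifferentiableAt ℝ (chartForm p θ) (extChartAt (𝓡 n) p p) := by
  refine differentiableAt_continuousAlternatingMap_of_apply fun v => ?_
  refine (differentiableAt_comp_extChartAt_symm (hθ v)).congr_of_eventuallyEq ?_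
  filter_upwards [extChartAt_target_mem_nhds (I := 𝓡 n) p] with y hy
  exact congrArg (θ _) (funext fun i => (extend_eq_mfderiv_extChartAt_symm (v i) hy).symm)

theorem formExtDeriv_apply {k : ℕ} (θ : ∀ q : M, TangentSpace (𝓡 n) q [⋀^Fin k]→L[ℝ] ℝ) (p : M)
    (v : Fin (k + 1) → TangentSpace (𝓡 n) p) :
    formExtDeriv θ p v = extDeriv (chartForm p θ) (extChartAt (𝓡 n) p p) v := by
  unfold formExtDeriv
  rw [mfderiv_extChartAt_self]
  rfl

/-- A formula for the exterior derivative of a `2`-form in terms of Lie brackets. -/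
theorem formExtDeriv_apply_vectorField {p : M}
    {θ : ∀ q : M, TangentSpace (𝓡 n) q [⋀^Fin 2]→L[ℝ] ℝ}
    (hθ : ∀ X Y : ∀ q : M, TangentSpace (𝓡 n) q, MDifferentiableFieldAt X p → MDifferentiableFieldAt Y p →
      MDifferentiableAt (𝓡 n) 𝓘(ℝ, ℝ) (fun q => θ q ![X q, Y q]) p)
    {X Y Z : ∀ q : M, TangentSpace (𝓡 n) q}
    (hX : MDifferentiableFieldAt X p) (hY : MDifferentiableFieldAt Y p) (hZ : MDifferentiableFieldAt Z p) :
    formExtDeriv θ p ![X p, Y p, Z p]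
      = AlmostContactMetric.dirDeriv (fun q => θ q ![Y q, Z q]) p (X p)
        - AlmostContactMetric.dirDeriv (fun q => θ q ![X q, Z q]) p (Y p)
        + AlmostContactMetric.dirDeriv (fun q => θ q ![X q, Y q]) p (Z p)
        - θ p ![VectorField.mlieBracket (𝓡 n) X Y p, Z p]
        + θ p ![VectorField.mlieBracket (𝓡 n) X Z p, Y p]
        - θ p ![VectorField.mlieBracket (𝓡 n) Y Z p, X p] := by
  have hdθ : DifferentiableAt ℝ (chartForm p θ) (extChartAt (𝓡 n) p p) := by
    refine differentiableAt_chartForm fun v => ?_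
    have h := hθ _ _ (FiberBundle.mdifferentiableAt_extend (𝓡 n) (EuclideanSpace ℝ (Fin n)) (v 0))
      (FiberBundle.mdifferentiableAt_extend (𝓡 n) (EuclideanSpace ℝ (Fin n)) (v 1))
    convert h using 3 with q
    ext i : 1; fin_cases i <;> rfl
  have hpair : ∀ U V : ∀ q : M, TangentSpace (𝓡 n) q, ∀ T : ∀ q : M, TangentSpace (𝓡 n) q,
      MDifferentiableFieldAt U p → MDifferentiableFieldAt V p →
      fderiv ℝ (fun y => chartForm p θ y ![chartVectorField p U y, chartVectorField p V y])
        (extChartAt (𝓡 n) p p) (chartVectorField p T (extChartAt (𝓡 n) p p)) =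
        AlmostContactMetric.dirDeriv (fun q => θ q ![U q, V q]) p (T p) := by
    intro U V T hU hV
    rw [dirDeriv_eq_fderiv (hθ U V hU hV), chartVectorField_self]
    congr 1
    apply Filter.EventuallyEq.fderiv_eq
    filter_upwards [extChartAt_target_mem_nhds (I := 𝓡 n) p] with y hy
    have h := chartForm_chartVectorField θ ![U, V] hy
    have e1 : (fun i => chartVectorField p ((![U, V] : Fin 2 → ∀ q : M, TangentSpace (𝓡 n) q) i) y)
        = ![chartVectorField p U y, chartVectorField p V y] := by
      ext i : 1; fin_cases i <;> rfl
    rw [e1] at h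
    refine h.trans (congrArg (θ _) ?_)
    ext i : 1; fin_cases i <;> rfl
  rw [formExtDeriv_apply]
  have e3 : (![X p, Y p, Z p] : Fin 3 → TangentSpace (𝓡 n) p) =
      ![chartVectorField p X (extChartAt (𝓡 n) p p), chartVectorField p Y (extChartAt (𝓡 n) p p),
        chartVectorField p Z (extChartAt (𝓡 n) p p)] := by
    ext i : 1
    fin_cases i <;> exact (chartVectorField_self p _).symm
  rw [e3]
  refine (extDeriv_apply_vectorField_two hdθ (differentiableAt_chartVectorField hX)
    (differentiableAt_chartVectorField hY) (differentiableAt_chartVectorField hZ)).trans ?_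
  have hbr : ∀ U V T : ∀ q : M, TangentSpace (𝓡 n) q,
      chartForm p θ (extChartAt (𝓡 n) p p)
        ![VectorField.lieBracket ℝ (chartVectorField p U) (chartVectorField p V)
          (extChartAt (𝓡 n) p p), chartVectorField p T (extChartAt (𝓡 n) p p)]
        = θ p ![VectorField.mlieBracket (𝓡 n) U V p, T p] := by
    intro U V T
    rw [mlieBracket_eq_lieBracket_chartVectorField, ← chartVectorField_self p T]
    exact chartForm_self p θ _
  rw [hpair _ _ _ hY hZ, hpair _ _ _ hX hZ, hpair _ _ _ hX hY, hbr, hbr, hbr]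

end Chart

/-! ### Invariance of `φ` and `F` under the Reeb field. -/

namespace AlmostContactMetric

variable {n : ℕ} {M : Type*} [TopologicalSpace M]
  [ChartedSpace (EuclideanSpace ℝ (Fin n)) M] [IsManifold (𝓡 n) ∞ M]

omit [IsManifold (𝓡 n) ∞ M] in
theorem dirDeriv_const (c : ℝ) (p : M) (v : TangentSpace (𝓡 n) p) :
    dirDeriv (fun _ : M => c) p v = 0 := by
  unfold dirDeriv
  rw [mfderiv_const]
  rfl

/-- The smooth vector field `φ X`. -/
noncomputable def φField (A : AlmostContactMetric n M)
    (X : ContMDiffSection (𝓡 n) (EuclideanSpace ℝ (Fin n)) ∞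
      (fun p : M => TangentSpace (𝓡 n) p)) :
    ContMDiffSection (𝓡 n) (EuclideanSpace ℝ (Fin n)) ∞ (fun p : M => TangentSpace (𝓡 n) p) :=
  ⟨fun q => A.φ q (X q), A.φ.contMDiff.clm_bundle_apply X.contMDiff⟩

theorem mdifferentiableAt_F_apply (A : AlmostContactMetric n M) {p : M}
    {X Y : ∀ q : M, TangentSpace (𝓡 n) q} (hX : MDifferentiableFieldAt X p)
    (hY : MDifferentiableFieldAt Y p) :
    MDifferentiableAt (𝓡 n) 𝓘(ℝ, ℝ) (fun q => A.F q ![X q, Y q]) p := by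
  have h1 : MDifferentiableFieldAt (fun q => A.φ q (X q)) p :=
    A.φ.mdifferentiableAt.clm_bundle_apply hX
  have hg := A.g.contMDiff.mdifferentiableAt (x := p) (by simp)
  have h2 := MDifferentiableAt.clm_bundle_apply₂ (F₃ := ℝ) (E₃ := Bundle.Trivial M ℝ) hg h1 hY
  rw [mdifferentiableAt_totalSpace] at h2
  exact h2.2

/-- The Reeb field of a normal structure with Killing Reeb field preserves `φ`. -/
theorem IsST.mlieBracket_ξ_φ {A : AlmostContactMetric n M} (hA : A.IsST)
    (Y : ContMDiffSection (𝓡 n) (EuclideanSpace ℝ (Fin n)) ∞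
      (fun p : M => TangentSpace (𝓡 n) p)) (p : M) :
    VectorField.mlieBracket (𝓡 n) A.ξ (fun q => A.φ q (Y q)) p
      = A.φ p (VectorField.mlieBracket (𝓡 n) A.ξ Y p) := by
  have hN := hA.normal A.ξ Y p
  unfold sasakiHatakeyama at hN
  have h0 : (fun q => A.φ q (A.ξ q)) = (0 : ∀ q : M, TangentSpace (𝓡 n) q) := funext A.φ_ξ
  rw [h0, VectorField.mlieBracket_zero_left, VectorField.mlieBracket_zero_left, Pi.zero_apply,
    map_zero, zero_add, sub_zero] at hN
  -- The Killing condition on the pair `(ξ, φY)` yields `η([ξ, φY]) = 0`, since `η(φY) = 0` and `[ξ,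
  -- ξ] = 0`.
  have hη := hA.killing A.ξ (A.φField Y) p
  have hc : (fun q => A.g.inner q (A.ξ q) (A.φField Y q)) = fun _ => (0 : ℝ) :=
    funext fun q => A.η_φ q (Y q)
  rw [hc, dirDeriv_const, VectorField.mlieBracket_self, Pi.zero_apply, map_zero, zero_apply,
    sub_zero, zero_sub, neg_eq_zero] at hη
  change A.g.inner p (A.ξ p) (VectorField.mlieBracket (𝓡 n) A.ξ (fun q => A.φ q (Y q)) p) = 0 at hη
  -- Applying `φ` removes the unknown `dη(ξ, Y) ξ`, and nothing else is lost because `[ξ, φY]` is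
  -- horizontal.
  have h := congrArg (A.φ p) hN
  rw [map_add, map_sub, map_smul, A.φ_ξ, smul_zero, add_zero, map_zero, A.φ_sq p (A.φ p _),
    A.φ_sq, A.η_φ, hη, zero_smul, add_zero, add_zero, sub_neg_eq_add,
    neg_add_eq_zero] at h
  exact h.symm

/-- Cartan's formula in substance: `ι_ξ F = 0` leaves only the terms of `(ℒ_ξ F)(Y, Z)`. These
cancel by the Killing condition on `(φY, Z)` after `[ξ, φY]` is replaced by `φ[ξ, Y]`. -/
theorem IsST.dF_ξ [T2Space M] {A : AlmostContactMetric n M} (hA : A.IsST) (p : M)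
    (Y Z : TangentSpace (𝓡 n) p) : A.dF p ![A.ξ p, Y, Z] = 0 := by
  obtain ⟨Y, rfl⟩ := exists_contMDiffSection_eq p Y
  obtain ⟨Z, rfl⟩ := exists_contMDiffSection_eq p Z
  have h := formExtDeriv_apply_vectorField (θ := A.F) (fun X Y => A.mdifferentiableAt_F_apply)
    A.ξ.mdifferentiableAt (Y.mdifferentiableAt (x := p)) Z.mdifferentiableAt
  have hK := hA.killing (A.φField Y) Z p
  have hL := hA.mlieBracket_ξ_φ Y p
  have h1 : (fun q => A.F q ![A.ξ q, Z q]) = fun _ => (0 : ℝ) := by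
    funext q; simp [A.φ_ξ]
  have h2 : (fun q => A.F q ![A.ξ q, Y q]) = fun _ => (0 : ℝ) := by
    funext q; simp [A.φ_ξ]
  have e : A.dF p ![A.ξ p, Y p, Z p] = _ := h
  rw [h1, h2, dirDeriv_const, dirDeriv_const] at e
  change dirDeriv (fun q => A.F q ![Y q, Z q]) p (A.ξ p)
    - A.g.inner p (VectorField.mlieBracket (𝓡 n) A.ξ (fun q => A.φ q (Y q)) p) (Z p)
    - A.g.inner p (A.φ p (Y p)) (VectorField.mlieBracket (𝓡 n) A.ξ Z p) = 0 at hK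
  rw [hL] at hK
  have hF : ∀ U V, A.F p ![U, V] = A.g.inner p (A.φ p U) V := fun _ _ => rfl
  rw [hF, hF, hF, A.inner_φ_left p (VectorField.mlieBracket (𝓡 n) A.ξ Z p), A.inner_φ_left p _
    (A.ξ p), A.φ_ξ, map_zero, A.g.symm p _ (A.φ p (Y p))] at e
  linarith

end AlmostContactMetric

theorem mainTheorem9 {M : Type*} [TopologicalSpace M] [T2Space M]
    [ChartedSpace (EuclideanSpace ℝ (Fin 5)) M] [IsManifold (𝓡 5) ∞ M]
    (A : AlmostContactMetric 5 M) (hA : A.IsST) :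
    (∀ (p : M) (X Y Z : TangentSpace (𝓡 5) p),
        A.dF p ![X, Y, Z] = wedgeOneTwo (A.leeForm p) (fun U V => A.F p ![U, V]) X Y Z) ∧
      (A.IsBalanced ↔ A.IsQuasiSasaki) := by
  have key : ∀ (p : M) (X Y Z : TangentSpace (𝓡 5) p),
      A.dF p ![X, Y, Z] = wedgeOneTwo (A.leeForm p) (fun U V => A.F p ![U, V]) X Y Z :=
    fun p => A.dF_eq_wedge_of_horizontal p (hA.dF_ξ p)
  refine ⟨key, fun hb => ⟨hA.normal, fun p => ?_⟩, fun hq p X => ?_⟩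
  · ext v
    have hv : v = ![v 0, v 1, v 2] := by ext i : 1; fin_cases i <;> rfl
    rw [hv, key]
    simp [wedgeOneTwo, hb p]
  · obtain ⟨u, v, he⟩ := A.exists_adapted_frame p
    rw [A.leeForm_eq_sum_dF p (hA.dF_ξ p) X he fun i => by
      have hu : A.g.inner p (A.ξ p) u = 0 := he 0 1
      have hv : A.g.inner p (A.ξ p) v = 0 := he 0 3
      fin_cases i <;> simp [hu, hv, A.η_φ]]
    simp [hq.closed p]
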